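/- **Setting.** Let $\Omega$ (the parameter space) be a metrizable topological space with its Borel $\sigma$-algebra, let $\mu$ be a measure on a measurable space $\mathcal Y$, and let $f(\cdot\mid\theta)$, $\theta\in\Omega$, be probability densities on $\mathcal Y$ with respect to $\mu$. Let $\mathcal P(\Omega)$ be the set of all Borel probability measures on $\Omega$, with the topology of weak convergence, and for $G\in\mathcal P(\Omega)$ let $f_G(y)=\int f(y\mid\vartheta)\,dG(\vartheta)$. Put $h(y)=\sup_{\theta\in\Omega}|\log f(y\mid\theta)|\in[0,\infty]$ (with $\log 0=-\infty$), and for $M>0$ let $\log f_G^{(M)}(y)$ be equal to $\log f_G(y)$ if $|\log f_G(y)|<M$ and to $M\cdot\operatorname{sign}(\log f_G(y))$ otherwise. Given $y_1,\dots,y_n\in\mathcal Y$, a generalized maximum likelihood estimate (GMLE) is any $\hat G\in\mathcal P(\Omega)$ that maximizes $\prod_{i=1}^n f_G(y_i)$ over all $G\in\mathcal P(\Omega)$. **Assumptions.** * (A1) $\Omega$ is compact. * (A2) $\sup_{\theta\in\Omega}\int h(y)^4 f(y\mid\theta)\,d\mu(y)<\infty$. * (A3) For every $y$ the map $\theta\mapsto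 f(y\mid\theta)$ is continuous, and $f(y\mid\theta)$ is bounded uniformly in $y$ and $\theta$. * (A4) Mixtures are identifiable: if $G,G'\in\mathcal P(\Omega)$ and $f_G=f_{G'}$ $\mu$-almost everywhere, then $G=G'$. * (A5) For every $G_0\in\mathcal P(\Omega)$, $\varepsilon>0$ and $M>0$, the set $\{G\in\mathcal P(\Omega): \|\log f_G^{(M)}-\log f_{G_0}^{(M)}\|_{\infty}<\varepsilon\}$ is open in the weak topology, where $\|\cdot\|_\infty$ is the norm of $L^\infty(\mu)$. **Theorem.** Assume A1–A5. Let $(\theta_i^n)_{1\le i\le n,\;n\ge1}$ be any triangular array of fixed points of $\Omega$, and let $G^n=\frac1n\sum_{i=1}^n\delta_{\theta_i^n}$ be the empirical distribution of its $n$-th row. On a probability space let $Y_i^n$, $1\le i\le n$, $n\ge1$, be random variables such that, for each $n$, $Y_1^n,\dots,Y_n^n$ are independent and $Y_i^n$ has density $f(\cdot\mid\theta_i^n)$ (nothing is assumed about the dependence between different rows). For each $n$ let $\hat G^n$ be, almost surely, a GMLE based on $Y_1^n,\dots,Y_n^n$. Then for every bounded continuous function $\varphi:\Omega\to\mathbb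 R$, almost surely, $$\int\varphi\,d\hat G^n-\int\varphi\,dG^n\;\longrightarrow\;0\qquad(n\to\infty).$$ Moreover, almost surely, this convergence holds simultaneously for all bounded continuous $\varphi$; that is, almost surely the signed measures $\hat G^n-G^n$ converge weakly to the zero measure. -/

import Mathlib

open MeasureTheory ProbabilityTheory Filter Topology
open scoped ENNReal NNReal BoundedContinuousFunction

noncomputable section

namespace GMLE

variable {Ω 𝒴 : Type*} [MeasurableSpace Ω]

/-- The mixture density `f_G(y) = ∫ f(y|ϑ) dG(ϑ)` of the family `f θ y = f(y|θ)`. -/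
def mixtureDensity (f : Ω → 𝒴 → ℝ≥0) (G : ProbabilityMeasure Ω) (y : 𝒴) : ℝ≥0∞ :=
  ∫⁻ ϑ, (f ϑ y : ℝ≥0∞) ∂(G : Measure Ω)

/-- The envelope `h(y) = sup_θ |log f(y|θ)|`, with values in `[0, ∞]`; here `log 0 = -∞`,
so that `h(y) = ∞` as soon as `f(y|θ) = 0` for some `θ`. -/
def logEnvelope {Ω 𝒴 : Type*} (f : Ω → 𝒴 → ℝ≥0) (y : 𝒴) : ℝ≥0∞ :=
  ⨆ θ, (ENNReal.log (f θ y : ℝ≥0∞)).abs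

/-- The logarithm truncated at level `M`: it is `log x` if `|log x| < M`, and
`M * sign (log x)` otherwise. In particular it is `-M` at `x = 0`. -/
def truncLog (M : ℝ) (x : ℝ≥0∞) : ℝ :=
  if (ENNReal.log x).abs < ENNReal.ofReal M then (ENNReal.log x).toReal
  else M * ((SignType.sign (ENNReal.log x) : SignType) : ℝ)

/-- The empirical distribution `(1/n) ∑ δ_{θ_i}` of the points `θ_1, …, θ_n`
(the zero measure for `n = 0`). -/
def empiricalMeasure {n : ℕ} (θ : Fin n → Ω) : Measure Ω :=
  (n : ℝ≥0∞)⁻¹ • ∑ i, Measure.dirac (θ i)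

/-- `G` is a generalized maximum likelihood estimate for the data `y_1, …, y_n`: it maximizes
`∏ f_G(y_i)` over all probability measures on the parameter space. -/
def IsGMLE (f : Ω → 𝒴 → ℝ≥0) {n : ℕ} (y : Fin n → 𝒴) (G : ProbabilityMeasure Ω) : Prop :=
  ∀ G' : ProbabilityMeasure Ω,
    ∏ i, mixtureDensity f G' (y i) ≤ ∏ i, mixtureDensity f G (y i)

end GMLE

end

/-!
The estimate is consistent because its Kullback–Leibler divergence from the true mixture vanishes,
and because on a compact parameter space this divergence controls the weak topology.

Let `L_n(G)` be the normalized log-likelihood of the `n`-th row and `λ_n(G)` its expectation. A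
maximizer satisfies `L_n(Ĝⁿ) ≥ L_n(Gⁿ)`. If `sup_G |L_n(G) - λ_n(G)| → 0` almost surely, then
`λ_n(Gⁿ) - λ_n(Ĝⁿ)` has a nonpositive upper limit. This difference is the expected log-likelihood
ratio under the mixture with mixing distribution `Gⁿ`, so it bounds the divergence of the estimated
mixture from that one (`mixtureDivergence_le`). Along any subsequence the space of mixing
distributions, being compact and metrizable, provides limits of `Ĝⁿ` and `Gⁿ`; Fatou's lemma shows
that their mixture densities agree `μ`-almost everywhere, and identifiability that the limits
coincide (`tendsto_integral_sub_of_mixtureDivergence`). The exceptional null set comes from the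
uniform law of large numbers alone, so the convergence holds for all test functions at once.

The uniform law (`ae_forall_eventually_abs_average_le`) rests on two facts. Fourth moments of row
averages of centred independent variables are `O(n⁻²)`, which is summable, so the strong law holds
for triangular arrays regardless of the dependence between rows
(`tendsto_average_sub_integral_of_fourth_moment`). And finitely many of the open sets on which the
truncated log densities are uniformly close cover the space of mixing distributions
(`exists_finite_net`); the truncation error is at most twice the part of the envelope
`sup_θ |log f(y|θ)|` above the truncation level `M`, whose mean is at most `K / M³` by the fourth
moment bound. The uncountably many null sets in the `L^∞` bounds reduce to countably many since
`G ↦ log f_G(y)` is weakly continuous for each `y` with finite envelope.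

The measure `μ` is not assumed σ-finite. Tonelli's theorem is applied on `regularSet f`, the set of
finite envelope, where `μ` is s-finite because a probability density is positive there; outside
this set all densities vanish.
-/

noncomputable section

namespace GMLE

/-! ### A strong law of large numbers for triangular arrays -/

section TriangularSLLN

variable {S : Type*} [MeasurableSpace S] {P : Measure S} [IsProbabilityMeasure P]

lemma integrable_pow_of_memLp_four {U : S → ℝ} (hU : MemLp U 4 P) {k : ℕ} (hk : k ≤ 4) :
    Integrable (fun ω => U ω ^ k) P := by
  rcases Nat.eq_zero_or_pos k with rfl | hk0
  · simp
  · have h1 : MemLp U (k : ℝ≥0∞) P := hU.mono_exponent (by exact_mod_cast hk)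
    have h2 := h1.integrable_norm_pow hk0.ne'
    refine h2.mono (hU.1.pow k) (ae_of_all _ fun ω => ?_)
    simp

lemma integral_pow_mul_pow_of_indepFun {U V : S → ℝ} (hU : MemLp U 4 P) (hV : MemLp V 4 P)
    (hUV : IndepFun U V P) {j k : ℕ} (hj : j ≤ 4) (hk : k ≤ 4) :
    Integrable (fun ω => U ω ^ j * V ω ^ k) P ∧
      ∫ ω, U ω ^ j * V ω ^ k ∂P = (∫ ω, U ω ^ j ∂P) * ∫ ω, V ω ^ k ∂P := by
  have hind : IndepFun (fun ω => U ω ^ j) (fun ω => V ω ^ k) P :=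
    hUV.comp (φ := fun x : ℝ => x ^ j) (ψ := fun x : ℝ => x ^ k) (by fun_prop) (by fun_prop)
  exact ⟨hind.integrable_mul (integrable_pow_of_memLp_four hU hj)
      (integrable_pow_of_memLp_four hV hk),
    hind.integral_fun_mul_eq_mul_integral (hU.1.pow j) (hV.1.pow k)⟩

lemma integral_sq_add_of_indepFun {U V : S → ℝ} (hU : MemLp U 4 P) (hV : MemLp V 4 P)
    (hUV : IndepFun U V P) (hV0 : ∫ ω, V ω ∂P = 0) :
    ∫ ω, (U ω + V ω) ^ 2 ∂P = ∫ ω, U ω ^ 2 ∂P + ∫ ω, V ω ^ 2 ∂P := by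
  obtain ⟨i11, e11⟩ := integral_pow_mul_pow_of_indepFun hU hV hUV (j := 1) (k := 1)
    (by norm_num) (by norm_num)
  have i20 := integrable_pow_of_memLp_four hU (k := 2) (by norm_num)
  have i02 := integrable_pow_of_memLp_four hV (k := 2) (by norm_num)
  have : ∀ ω, (U ω + V ω) ^ 2 = U ω ^ 2 + 2 * (U ω ^ 1 * V ω ^ 1) + V ω ^ 2 := fun ω => by ring
  simp_rw [this]
  rw [integral_add (i20.fun_add (i11.const_mul 2)) i02, integral_add i20 (i11.const_mul 2),
    integral_const_mul, e11]
  simp [hV0]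

lemma integral_pow_four_add_of_indepFun {U V : S → ℝ} (hU : MemLp U 4 P) (hV : MemLp V 4 P)
    (hUV : IndepFun U V P) (hU0 : ∫ ω, U ω ∂P = 0) (hV0 : ∫ ω, V ω ∂P = 0) :
    ∫ ω, (U ω + V ω) ^ 4 ∂P = ∫ ω, U ω ^ 4 ∂P
      + 6 * ((∫ ω, U ω ^ 2 ∂P) * ∫ ω, V ω ^ 2 ∂P) + ∫ ω, V ω ^ 4 ∂P := by
  obtain ⟨i31, e31⟩ := integral_pow_mul_pow_of_indepFun hU hV hUV (j := 3) (k := 1)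
    (by norm_num) (by norm_num)
  obtain ⟨i22, e22⟩ := integral_pow_mul_pow_of_indepFun hU hV hUV (j := 2) (k := 2)
    (by norm_num) (by norm_num)
  obtain ⟨i13, e13⟩ := integral_pow_mul_pow_of_indepFun hU hV hUV (j := 1) (k := 3)
    (by norm_num) (by norm_num)
  have i40 := integrable_pow_of_memLp_four hU (k := 4) le_rfl
  have i04 := integrable_pow_of_memLp_four hV (k := 4) le_rfl
  have : ∀ ω, (U ω + V ω) ^ 4 = U ω ^ 4 + 4 * (U ω ^ 3 * V ω ^ 1) + 6 * (U ω ^ 2 * V ω ^ 2)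
      + 4 * (U ω ^ 1 * V ω ^ 3) + V ω ^ 4 := fun ω => by ring
  simp_rw [this]
  rw [integral_add (((i40.fun_add (i31.const_mul 4)).fun_add (i22.const_mul 6)).fun_add
      (i13.const_mul 4)) i04,
    integral_add ((i40.fun_add (i31.const_mul 4)).fun_add (i22.const_mul 6)) (i13.const_mul 4),
    integral_add (i40.fun_add (i31.const_mul 4)) (i22.const_mul 6),
    integral_add i40 (i31.const_mul 4), integral_const_mul, integral_const_mul,
    integral_const_mul, e31, e22, e13]
  simp [hV0, hU0]

lemma sq_integral_le_integral_sq {V : S → ℝ} (h1 : Integrable V P)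
    (h2 : Integrable (fun ω => V ω ^ 2) P) : (∫ ω, V ω ∂P) ^ 2 ≤ ∫ ω, V ω ^ 2 ∂P := by
  set a := ∫ ω, V ω ∂P with ha
  have h0 : 0 ≤ ∫ ω, (V ω - a) ^ 2 ∂P := integral_nonneg fun ω => sq_nonneg _
  have : ∀ ω, (V ω - a) ^ 2 = V ω ^ 2 + -2 * a * V ω + a ^ 2 := fun ω => by ring
  simp_rw [this] at h0
  rw [integral_add (h2.fun_add (h1.const_mul _)) (integrable_const _),
    integral_add h2 (h1.const_mul _), integral_const_mul, ← ha] at h0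
  simp at h0
  linarith

lemma sq_integral_sq_le {U : S → ℝ} (hU : MemLp U 4 P) :
    (∫ ω, U ω ^ 2 ∂P) ^ 2 ≤ ∫ ω, U ω ^ 4 ∂P := by
  have h := sq_integral_le_integral_sq (integrable_pow_of_memLp_four hU (k := 2) (by norm_num))
    (by simpa only [← pow_mul] using integrable_pow_of_memLp_four hU (k := 4) le_rfl)
  simpa only [← pow_mul] using h

/-- A Marcinkiewicz–Zygmund type bound: the fourth moment of a sum of `k` independent centred
variables is at most `3 k² K` when each fourth moment is at most `K`. -/
lemma integral_sum_pow_four_le {ι : Type*} [DecidableEq ι] {X : ι → S → ℝ} {K : ℝ}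
    (hX : ∀ i, MemLp (X i) 4 P) (hind : iIndepFun X P) (h0 : ∀ i, ∫ ω, X i ω ∂P = 0)
    (hK : ∀ i, ∫ ω, X i ω ^ 4 ∂P ≤ K) (s : Finset ι) :
    ∫ ω, (∑ i ∈ s, X i ω) ^ 4 ∂P ≤ 3 * (s.card : ℝ) ^ 2 * K := by
  suffices H : (∫ ω, (∑ i ∈ s, X i ω) ^ 2 ∂P ≤ s.card * √K) ∧
      ∫ ω, (∑ i ∈ s, X i ω) ^ 4 ∂P ≤ 3 * (s.card : ℝ) ^ 2 * K from H.2
  induction s using Finset.induction_on with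
  | empty => simp
  | insert a s has ih =>
    have hK0 : 0 ≤ K := (integral_nonneg fun ω => by positivity).trans (hK a)
    have hS : MemLp (fun ω => ∑ i ∈ s, X i ω) 4 P := memLp_finsetSum s fun i _ => hX i
    have hSa : IndepFun (fun ω => ∑ i ∈ s, X i ω) (X a) P := by
      have := hind.indepFun_finsetSum_of_notMem₀ (fun i => (hX i).1.aemeasurable) has
      convert this using 1
      ext ω; simp
    have hS0 : ∫ ω, ∑ i ∈ s, X i ω ∂P = 0 := by
      rw [integral_finsetSum _ fun i _ => (hX i).integrable (by norm_num)]
      simp [h0]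
    have e2 := integral_sq_add_of_indepFun hS (hX a) hSa (h0 a)
    have e4 := integral_pow_four_add_of_indepFun hS (hX a) hSa hS0 (h0 a)
    have hv0 : 0 ≤ ∫ ω, X a ω ^ 2 ∂P := integral_nonneg fun ω => sq_nonneg _
    have hv : ∫ ω, X a ω ^ 2 ∂P ≤ √K :=
      Real.le_sqrt_of_sq_le ((sq_integral_sq_le (hX a)).trans (hK a))
    simp_rw [Finset.sum_insert has, Finset.card_insert_of_notMem has,
      add_comm (X a _)]
    rw [e2, e4]
    push_cast
    refine ⟨by linarith [ih.1], ?_⟩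
    have hprod : (∫ ω, (∑ i ∈ s, X i ω) ^ 2 ∂P) * ∫ ω, X a ω ^ 2 ∂P ≤ s.card * K := by
      calc _ ≤ (s.card * √K) * √K := mul_le_mul ih.1 hv hv0 (by positivity)
        _ = s.card * K := by rw [mul_assoc, Real.mul_self_sqrt hK0]
    nlinarith [ih.2, hK a]

/-- Strong law of large numbers for a triangular array of row-wise independent real variables
with uniformly bounded fourth moments. Nothing is assumed about the joint law of distinct rows:
the fourth moments of the row averages are `O(n⁻²)`, hence summable. -/
theorem tendsto_average_sub_integral_of_fourth_moment {X : (n : ℕ) → Fin n → S → ℝ} {K : ℝ}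
    (hX : ∀ n i, MemLp (X n i) 4 P) (hind : ∀ n, iIndepFun (X n) P)
    (hK : ∀ n i, ∫ ω, X n i ω ^ 4 ∂P ≤ K) :
    ∀ᵐ ω ∂P, Tendsto (fun n : ℕ => (n : ℝ)⁻¹ * ∑ i, (X n i ω - ∫ ω', X n i ω' ∂P))
      atTop (𝓝 0) := by
  set Z : (n : ℕ) → Fin n → S → ℝ := fun n i ω => X n i ω - ∫ ω', X n i ω' ∂P with hZ
  have hZm : ∀ n i, MemLp (Z n i) 4 P := fun n i => (hX n i).sub (memLp_const _)
  have hZind : ∀ n, iIndepFun (Z n) P := fun n =>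
    (hind n).comp (fun i x => x - ∫ ω', X n i ω' ∂P) fun i => by fun_prop
  have hZ0 : ∀ n i, ∫ ω, Z n i ω ∂P = 0 := fun n i => by
    simp only [hZ]
    rw [integral_sub ((hX n i).integrable (by norm_num)) (integrable_const _)]
    simp
  have hZK : ∀ n i, ∫ ω, Z n i ω ^ 4 ∂P ≤ 16 * K := fun n i => by
    set m := ∫ ω', X n i ω' ∂P with hm
    have i4 := integrable_pow_of_memLp_four (hX n i) (k := 4) le_rfl
    have hm2 : m ^ 2 ≤ ∫ ω, X n i ω ^ 2 ∂P :=
      sq_integral_le_integral_sq ((hX n i).integrable (by norm_num))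
        (integrable_pow_of_memLp_four (hX n i) (by norm_num))
    have hm4 : m ^ 4 ≤ K := calc
      m ^ 4 = (m ^ 2) ^ 2 := by ring
      _ ≤ (∫ ω, X n i ω ^ 2 ∂P) ^ 2 := by gcongr
      _ ≤ _ := (sq_integral_sq_le (hX n i)).trans (hK n i)
    calc ∫ ω, Z n i ω ^ 4 ∂P ≤ ∫ ω, (8 * X n i ω ^ 4 + 8 * m ^ 4) ∂P := by
          refine integral_mono (integrable_pow_of_memLp_four (hZm n i) le_rfl)
            ((i4.const_mul 8).add (integrable_const _)) fun ω => ?_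
          have h := (even_two_mul 2).add_pow_le (a := X n i ω) (b := -m)
          norm_num at h
          simp only [hZ]
          linarith [h]
      _ = 8 * ∫ ω, X n i ω ^ 4 ∂P + 8 * m ^ 4 := by
          rw [integral_add (i4.const_mul 8) (integrable_const _), integral_const_mul]; simp
      _ ≤ 16 * K := by linarith [hK n i]
  have hint : ∀ n : ℕ, Integrable (fun ω => ((n : ℝ)⁻¹ * ∑ i, Z n i ω) ^ 4) P := fun n =>
    integrable_pow_of_memLp_four
      ((memLp_finsetSum Finset.univ fun i _ => hZm n i).const_mul _) le_rfl
  have hbound : ∀ n : ℕ, ∫⁻ ω, ENNReal.ofReal (((n : ℝ)⁻¹ * ∑ i, Z n i ω) ^ 4) ∂P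
      ≤ ENNReal.ofReal (48 * K * (1 / (n : ℝ) ^ 2)) := fun n => by
    rw [← ofReal_integral_eq_lintegral_ofReal (hint n) (ae_of_all _ fun ω => by positivity)]
    refine ENNReal.ofReal_le_ofReal ?_
    simp_rw [mul_pow]
    rw [integral_const_mul]
    have h := integral_sum_pow_four_le (hZm n) (hZind n) (hZ0 n) (hZK n) Finset.univ
    rw [Finset.card_univ, Fintype.card_fin] at h
    calc ((n : ℝ)⁻¹) ^ 4 * ∫ ω, (∑ i, Z n i ω) ^ 4 ∂P
        ≤ ((n : ℝ)⁻¹) ^ 4 * (3 * (n : ℝ) ^ 2 * (16 * K)) := by gcongr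
      _ = 48 * K * (1 / (n : ℝ) ^ 2) := by
        rcases eq_or_ne (n : ℝ) 0 with h | h
        · simp [h]
        · field_simp; ring
  have hsum : ∑' n : ℕ, ∫⁻ ω, ENNReal.ofReal (((n : ℝ)⁻¹ * ∑ i, Z n i ω) ^ 4) ∂P ≠ ∞ := by
    refine ne_top_of_le_ne_top ?_ (ENNReal.tsum_le_tsum hbound)
    exact ((Real.summable_one_div_nat_pow.2 one_lt_two).mul_left _).tsum_ofReal_ne_top
  rw [← lintegral_tsum fun n => (hint n).1.aemeasurable.ennreal_ofReal] at hsum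
  filter_upwards [ae_lt_top' (AEMeasurable.tsum fun n =>
    (hint n).1.aemeasurable.ennreal_ofReal) hsum] with ω hω
  have h := (ENNReal.tendsto_toReal (by simp)).comp
    (ENNReal.tendsto_atTop_zero_of_tsum_ne_top hω.ne)
  have h4 : Tendsto (fun n : ℕ => ((n : ℝ)⁻¹ * ∑ i, Z n i ω) ^ 4) atTop (𝓝 0) := by
    refine h.congr fun n => ?_
    simp only [Function.comp]
    exact ENNReal.toReal_ofReal (by positivity)
  -- a square root applied twice turns the fourth power into the absolute value
  have h5 := (Real.continuous_sqrt.tendsto _).comp ((Real.continuous_sqrt.tendsto _).comp h4)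
  simp only [Real.sqrt_zero] at h5
  refine tendsto_zero_iff_abs_tendsto_zero _ |>.2 (h5.congr fun n => ?_)
  simp only [Function.comp]
  rw [show ∀ x : ℝ, x ^ 4 = (x ^ 2) ^ 2 from fun x => by ring, Real.sqrt_sq (sq_nonneg _),
    Real.sqrt_sq_eq_abs]

end TriangularSLLN

/-! ### The logarithmic envelope and mixture densities -/

section Family

lemma continuous_ereal_abs : Continuous EReal.abs := by
  have h : EReal.abs = fun x => max x.toENNReal (-x).toENNReal := by
    ext1 x
    induction x with
    | bot => simp
    | top => simp
    | coe r =>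
      rw [EReal.abs_def, ← EReal.coe_neg, EReal.toENNReal_of_ne_top (by simp),
        EReal.toENNReal_of_ne_top (EReal.coe_ne_top _), EReal.toReal_coe, EReal.toReal_coe,
        ← ENNReal.ofReal_max]
      rfl
  rw [h]
  exact EReal.continuous_toENNReal.max (EReal.continuous_toENNReal.comp continuous_neg)

/-- The distribution of an observation with parameter `θ`. -/
abbrev sampleLaw {Ω 𝒴 : Type*} [MeasurableSpace 𝒴] (μ : Measure 𝒴) (f : Ω → 𝒴 → ℝ≥0) (θ : Ω) :
    Measure 𝒴 :=
  μ.withDensity fun y => (f θ y : ℝ≥0∞)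

/-- The real-valued envelope `sup_θ |log f(y|θ)|`, set to `0` where the supremum is infinite. -/
def realEnvelope {Ω 𝒴 : Type*} (f : Ω → 𝒴 → ℝ≥0) (y : 𝒴) : ℝ := (logEnvelope f y).toReal

/-- The observations at which all log densities are bounded uniformly in the parameter. -/
def regularSet {Ω 𝒴 : Type*} (f : Ω → 𝒴 → ℝ≥0) : Set 𝒴 := {y | logEnvelope f y < ∞}

/-- The contribution of envelope values at least `M`. -/
def envelopeTail {Ω 𝒴 : Type*} (f : Ω → 𝒴 → ℝ≥0) (M : ℝ) (y : 𝒴) : ℝ :=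
  if M ≤ realEnvelope f y then realEnvelope f y else 0

/-- The log density `log f_G(y)` of a mixture as a real number; it is meaningful on
`regularSet f`, where `f_G(y)` is positive and finite. -/
def logMixture {Ω 𝒴 : Type*} [MeasurableSpace Ω] (f : Ω → 𝒴 → ℝ≥0)
    (G : ProbabilityMeasure Ω) (y : 𝒴) : ℝ :=
  Real.log (mixtureDensity f G y).toReal

/-- A family of probability densities that is continuous in the parameter and whose
logarithmic envelope has fourth moments bounded by `K`. -/
structure IsRegularFamily {Ω 𝒴 : Type*} [TopologicalSpace Ω] [MeasurableSpace 𝒴]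
    (μ : Measure 𝒴) (f : Ω → 𝒴 → ℝ≥0) (K : ℝ≥0) : Prop where
  measurable : ∀ θ, Measurable (f θ)
  lintegral_eq_one : ∀ θ, ∫⁻ y, (f θ y : ℝ≥0∞) ∂μ = 1
  continuous : ∀ y, Continuous fun θ => f θ y
  lintegral_envelope_le : ∀ θ, ∫⁻ y, logEnvelope f y ^ 4 ∂(sampleLaw μ f θ) ≤ K

variable {Ω 𝒴 : Type*} [MeasurableSpace Ω] {f : Ω → 𝒴 → ℝ≥0}

lemma envelopeTail_nonneg {Ω 𝒴 : Type*} (f : Ω → 𝒴 → ℝ≥0) (M : ℝ) (y : 𝒴) :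
    0 ≤ envelopeTail f M y := by
  rw [envelopeTail]; split_ifs
  exacts [ENNReal.toReal_nonneg, le_rfl]

lemma envelopeTail_le {Ω 𝒴 : Type*} (f : Ω → 𝒴 → ℝ≥0) (M : ℝ) (y : 𝒴) :
    envelopeTail f M y ≤ realEnvelope f y := by
  rw [envelopeTail]; split_ifs
  exacts [le_rfl, ENNReal.toReal_nonneg]

lemma density_bounds {Ω 𝒴 : Type*} {f : Ω → 𝒴 → ℝ≥0} {y : 𝒴} (hy : logEnvelope f y < ∞) (θ : Ω) :
    ENNReal.ofReal (Real.exp (-(logEnvelope f y).toReal)) ≤ f θ y ∧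
      (f θ y : ℝ≥0∞) ≤ ENNReal.ofReal (Real.exp (logEnvelope f y).toReal) := by
  have h1 : (ENNReal.log (f θ y : ℝ≥0∞)).abs ≤ logEnvelope f y :=
    le_iSup (fun θ => (ENNReal.log (f θ y : ℝ≥0∞)).abs) θ
  have h0 : f θ y ≠ 0 := by
    intro h0
    rw [h0] at h1
    simp only [ENNReal.coe_zero, ENNReal.log_zero, EReal.abs_bot, top_le_iff] at h1
    exact hy.ne h1
  have hpos : (0 : ℝ) < f θ y := by positivity
  rw [ENNReal.log_of_nnreal h0, EReal.abs_def,
    ENNReal.ofReal_le_iff_le_toReal hy.ne, abs_le] at h1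
  rw [← ENNReal.ofReal_coe_nnreal]
  exact ⟨ENNReal.ofReal_le_ofReal ((Real.le_log_iff_exp_le hpos).1 h1.1),
    ENNReal.ofReal_le_ofReal ((Real.log_le_iff_le_exp hpos).1 h1.2)⟩

lemma mixtureDensity_bounds {y : 𝒴} (hy : y ∈ regularSet f) (G : ProbabilityMeasure Ω) :
    ENNReal.ofReal (Real.exp (-realEnvelope f y)) ≤ mixtureDensity f G y ∧
      mixtureDensity f G y ≤ ENNReal.ofReal (Real.exp (realEnvelope f y)) := by
  constructor
  · calc _ = ∫⁻ _, ENNReal.ofReal (Real.exp (-realEnvelope f y)) ∂(G : Measure Ω) := by simp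
      _ ≤ _ := lintegral_mono fun θ => (density_bounds hy θ).1
  · calc _ ≤ ∫⁻ _, ENNReal.ofReal (Real.exp (realEnvelope f y)) ∂(G : Measure Ω) :=
          lintegral_mono fun θ => (density_bounds hy θ).2
      _ = _ := by simp

lemma mixtureDensity_ne_zero {y : 𝒴} (hy : y ∈ regularSet f) (G : ProbabilityMeasure Ω) :
    mixtureDensity f G y ≠ 0 := fun h => by
  have := (mixtureDensity_bounds hy G).1
  rw [h, nonpos_iff_eq_zero, ENNReal.ofReal_eq_zero] at this
  exact (Real.exp_pos _).not_ge this

lemma mixtureDensity_ne_top {y : 𝒴} (hy : y ∈ regularSet f) (G : ProbabilityMeasure Ω) :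
    mixtureDensity f G y ≠ ∞ :=
  ne_top_of_le_ne_top ENNReal.ofReal_ne_top (mixtureDensity_bounds hy G).2

lemma toReal_mixtureDensity_pos {y : 𝒴} (hy : y ∈ regularSet f) (G : ProbabilityMeasure Ω) :
    0 < (mixtureDensity f G y).toReal :=
  ENNReal.toReal_pos (mixtureDensity_ne_zero hy G) (mixtureDensity_ne_top hy G)

lemma abs_logMixture_le {y : 𝒴} (hy : y ∈ regularSet f) (G : ProbabilityMeasure Ω) :
    |logMixture f G y| ≤ realEnvelope f y := by
  obtain ⟨h1, h2⟩ := mixtureDensity_bounds hy G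
  have hpos := toReal_mixtureDensity_pos hy G
  rw [logMixture, abs_le, Real.le_log_iff_exp_le hpos, Real.log_le_iff_le_exp hpos]
  exact ⟨(ENNReal.ofReal_le_iff_le_toReal (mixtureDensity_ne_top hy G)).1 h1,
    ENNReal.toReal_le_of_le_ofReal (Real.exp_pos _).le h2⟩

lemma log_mixtureDensity {y : 𝒴} (hy : y ∈ regularSet f) (G : ProbabilityMeasure Ω) :
    ENNReal.log (mixtureDensity f G y) = (logMixture f G y : EReal) := by
  rw [ENNReal.log_pos_real (mixtureDensity_ne_zero hy G) (mixtureDensity_ne_top hy G),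
    logMixture]

/-- On the regular set the truncated log density is the log density clamped to `[-M, M]`. -/
lemma truncLog_mixtureDensity {M : ℝ} (hM : 0 < M) {y : 𝒴} (hy : y ∈ regularSet f)
    (G : ProbabilityMeasure Ω) :
    truncLog M (mixtureDensity f G y) = max (-M) (min M (logMixture f G y)) := by
  simp only [truncLog, log_mixtureDensity hy, EReal.abs_def, ENNReal.ofReal_lt_ofReal_iff hM,
    EReal.toReal_coe, EReal.sign_coe]
  split_ifs with h
  · rw [abs_lt] at h
    rw [min_eq_right h.2.le, max_eq_right h.1.le]
  · rw [not_lt, le_abs] at h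
    rcases h with h | h
    · rw [sign_pos (hM.trans_le h), min_eq_left h, max_eq_right (by linarith)]; simp
    · rw [sign_neg (by linarith), min_eq_right (by linarith), max_eq_left (by linarith)]; simp

section Continuity

variable [TopologicalSpace Ω] [BorelSpace Ω] [CompactSpace Ω]

lemma continuous_mixtureDensity (hf : ∀ y, Continuous fun θ => f θ y) (y : 𝒴) :
    Continuous fun G : ProbabilityMeasure Ω => mixtureDensity f G y :=
  ProbabilityMeasure.continuous_lintegral_boundedContinuousFunction
    (BoundedContinuousFunction.mkOfCompact ⟨fun θ => f θ y, hf y⟩)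

lemma continuous_toReal_mixtureDensity (hf : ∀ y, Continuous fun θ => f θ y) {y : 𝒴}
    (hy : y ∈ regularSet f) :
    Continuous fun G : ProbabilityMeasure Ω => (mixtureDensity f G y).toReal :=
  ENNReal.continuousOn_toReal.comp_continuous (continuous_mixtureDensity hf y)
    fun G => mixtureDensity_ne_top hy G

lemma continuous_logMixture (hf : ∀ y, Continuous fun θ => f θ y) {y : 𝒴}
    (hy : y ∈ regularSet f) :
    Continuous fun G : ProbabilityMeasure Ω => logMixture f G y :=
  (continuous_toReal_mixtureDensity hf hy).log fun G => (toReal_mixtureDensity_pos hy G).ne'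

end Continuity

lemma iSup_eq_iSup_denseSeq {Ω : Type*} [TopologicalSpace Ω] [TopologicalSpace.SeparableSpace Ω]
    [Nonempty Ω] {g : Ω → ℝ≥0∞} (hg : Continuous g) :
    ⨆ θ, g θ = ⨆ k, g (TopologicalSpace.denseSeq Ω k) := by
  refine le_antisymm (iSup_le fun θ => ?_) (iSup_le fun k => le_iSup g _)
  have hcl : IsClosed {θ | g θ ≤ ⨆ k, g (TopologicalSpace.denseSeq Ω k)} :=
    isClosed_le hg continuous_const
  refine hcl.closure_subset_iff.2 ?_ (TopologicalSpace.denseRange_denseSeq Ω θ)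
  rintro _ ⟨k, rfl⟩
  exact le_iSup (fun k => g (TopologicalSpace.denseSeq Ω k)) k

namespace IsRegularFamily

variable [MeasurableSpace 𝒴] {μ : Measure 𝒴} {K : ℝ≥0}

section

variable {Ω : Type*} [TopologicalSpace Ω] [TopologicalSpace.SeparableSpace Ω]
  [Nonempty Ω] {f : Ω → 𝒴 → ℝ≥0}

lemma measurable_logEnvelope (hf : IsRegularFamily μ f K) : Measurable (logEnvelope f) := by
  have h : logEnvelope f = fun y => ⨆ k,
      (ENNReal.log (f (TopologicalSpace.denseSeq Ω k) y : ℝ≥0∞)).abs := by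
    ext1 y
    exact iSup_eq_iSup_denseSeq (continuous_ereal_abs.comp
      (ENNReal.continuous_log.comp (ENNReal.continuous_coe.comp (hf.continuous y))))
  rw [h]
  exact .iSup fun k => continuous_ereal_abs.measurable.comp
    (ENNReal.continuous_log.measurable.comp (hf.measurable _).coe_nnreal_ennreal)

lemma measurable_realEnvelope (hf : IsRegularFamily μ f K) : Measurable (realEnvelope f) :=
  hf.measurable_logEnvelope.ennreal_toReal

lemma measurableSet_regularSet (hf : IsRegularFamily μ f K) : MeasurableSet (regularSet f) :=
  measurableSet_lt hf.measurable_logEnvelope measurable_const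

lemma ae_mem_regularSet (hf : IsRegularFamily μ f K) (θ : Ω) :
    ∀ᵐ y ∂(sampleLaw μ f θ), y ∈ regularSet f := by
  filter_upwards [ae_lt_top (hf.measurable_logEnvelope.pow_const 4)
    (ne_top_of_le_ne_top ENNReal.coe_ne_top (hf.lintegral_envelope_le θ))] with y hy
  by_contra h
  simp only [regularSet, Set.mem_ofPred_eq, not_lt, top_le_iff] at h
  simp [h] at hy

/-- Outside the regular set all densities vanish simultaneously, up to a `μ`-null set. -/
lemma ae_eq_zero_of_notMem_regularSet (hf : IsRegularFamily μ f K) :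
    ∀ᵐ y ∂μ, y ∉ regularSet f → ∀ θ, f θ y = 0 := by
  have h : ∀ k, ∀ᵐ y ∂μ, f (TopologicalSpace.denseSeq Ω k) y ≠ 0 → y ∈ regularSet f := fun k => by
    have := hf.ae_mem_regularSet (TopologicalSpace.denseSeq Ω k)
    rw [ae_withDensity_iff (hf.measurable _).coe_nnreal_ennreal] at this
    simpa using this
  filter_upwards [ae_all_iff.2 h] with y hy hyA θ
  have hcl : IsClosed {θ | f θ y = 0} := isClosed_eq (hf.continuous y) continuous_const
  refine hcl.closure_subset_iff.2 ?_ (TopologicalSpace.denseRange_denseSeq Ω θ)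
  rintro _ ⟨k, rfl⟩
  by_contra hne
  exact hyA (hy k hne)

lemma isProbabilityMeasure_sampleLaw {Ω : Type*} [TopologicalSpace Ω] {f : Ω → 𝒴 → ℝ≥0}
    (hf : IsRegularFamily μ f K) (θ : Ω) : IsProbabilityMeasure (sampleLaw μ f θ) :=
  ⟨by rw [withDensity_apply _ MeasurableSet.univ, setLIntegral_univ, hf.lintegral_eq_one]⟩

lemma sampleLaw_restrict (hf : IsRegularFamily μ f K) (θ : Ω) :
    sampleLaw (μ.restrict (regularSet f)) f θ = sampleLaw μ f θ := by
  rw [sampleLaw, ← restrict_withDensity hf.measurableSet_regularSet,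
    Measure.restrict_eq_self_of_ae_mem (hf.ae_mem_regularSet θ)]

lemma integral_sampleLaw (hf : IsRegularFamily μ f K) (θ : Ω) (g : 𝒴 → ℝ) :
    ∫ y, g y ∂(sampleLaw μ f θ) = ∫ y in regularSet f, (f θ y : ℝ) * g y ∂μ := by
  rw [← hf.sampleLaw_restrict, integral_withDensity_eq_integral_smul (hf.measurable θ)]
  simp [NNReal.smul_def]

/-- A measurable function dominated by the envelope has a uniformly bounded fourth moment. -/
lemma memLp_four (hf : IsRegularFamily μ f K) {g : 𝒴 → ℝ} (hg : Measurable g)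
    (hle : ∀ y ∈ regularSet f, |g y| ≤ realEnvelope f y) (θ : Ω) :
    MemLp g 4 (sampleLaw μ f θ) ∧ ∫ y, g y ^ 4 ∂(sampleLaw μ f θ) ≤ K := by
  have hlin : ∫⁻ y, ‖g y‖ₑ ^ 4 ∂(sampleLaw μ f θ) ≤ K := by
    refine (lintegral_mono_ae ?_).trans (hf.lintegral_envelope_le θ)
    filter_upwards [hf.ae_mem_regularSet θ] with y hy
    gcongr
    rw [Real.enorm_eq_ofReal_abs]
    exact ENNReal.ofReal_le_of_le_toReal (hle y hy)
  refine ⟨⟨hg.aestronglyMeasurable, ?_⟩, ?_⟩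
  · rw [eLpNorm_lt_top_iff_lintegral_rpow_enorm_lt_top (by norm_num) (by norm_num)]
    refine lt_of_le_of_lt ?_ (hlin.trans_lt ENNReal.coe_lt_top)
    simp
  · rw [integral_eq_lintegral_of_nonneg_ae (ae_of_all _ fun y => by positivity)
      (hg.pow_const 4).aestronglyMeasurable]
    refine ENNReal.toReal_le_of_le_ofReal K.2 ?_
    rw [show ENNReal.ofReal ((K : ℝ≥0) : ℝ) = K from ENNReal.ofReal_coe_nnreal]
    refine le_trans (le_of_eq (lintegral_congr fun y => ?_)) hlin
    rw [Real.enorm_eq_ofReal_abs, ← ENNReal.ofReal_pow (abs_nonneg _), Even.pow_abs (by decide)]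

/-- The regular part of `μ` is s-finite, although `μ` is arbitrary, because a single density
is positive there. -/
lemma sFinite_restrict_regularSet (hf : IsRegularFamily μ f K) :
    SFinite (μ.restrict (regularSet f)) := by
  let θ₀ : Ω := Classical.arbitrary Ω
  have := hf.isProbabilityMeasure_sampleLaw θ₀
  rw [← withDensity_inv_same (μ := μ.restrict (regularSet f))
    (f := fun y => (f θ₀ y : ℝ≥0∞)) (hf.measurable θ₀).coe_nnreal_ennreal ?_ (by simp)]
  · have h := hf.sampleLaw_restrict θ₀
    rw [sampleLaw] at h
    rw [h]
    infer_instance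
  · filter_upwards [ae_restrict_mem hf.measurableSet_regularSet] with y hy h0
    have := (density_bounds hy θ₀).1
    rw [h0, nonpos_iff_eq_zero, ENNReal.ofReal_eq_zero] at this
    exact (Real.exp_pos _).not_ge this

lemma measurable_envelopeTail (hf : IsRegularFamily μ f K) (M : ℝ) :
    Measurable (envelopeTail f M) :=
  Measurable.ite (measurableSet_le measurable_const hf.measurable_realEnvelope)
    hf.measurable_realEnvelope measurable_const

/-- Markov's inequality with the fourth moment of the envelope. -/
lemma integral_envelopeTail_le (hf : IsRegularFamily μ f K) {M : ℝ} (hM : 0 < M) (θ : Ω) :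
    ∫ y, envelopeTail f M y ∂(sampleLaw μ f θ) ≤ K / M ^ 3 := by
  have := hf.isProbabilityMeasure_sampleLaw θ
  have h4 := hf.memLp_four hf.measurable_realEnvelope
    (fun y _ => (abs_of_nonneg ENNReal.toReal_nonneg).le) θ
  calc ∫ y, envelopeTail f M y ∂(sampleLaw μ f θ)
      ≤ ∫ y, realEnvelope f y ^ 4 / M ^ 3 ∂(sampleLaw μ f θ) := by
        refine integral_mono_of_nonneg (ae_of_all _ fun y => envelopeTail_nonneg f M y)
          ((integrable_pow_of_memLp_four h4.1 le_rfl).div_const _) (ae_of_all _ fun y => ?_)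
        have h0 : 0 ≤ realEnvelope f y := ENNReal.toReal_nonneg
        simp only [envelopeTail]
        split_ifs with h
        · rw [le_div_iff₀ (by positivity), pow_succ' _ 3]
          gcongr
        · positivity
    _ = (∫ y, realEnvelope f y ^ 4 ∂(sampleLaw μ f θ)) / M ^ 3 := integral_div _ _
    _ ≤ K / M ^ 3 := by gcongr; exact h4.2

end

variable [TopologicalSpace Ω] [BorelSpace Ω] [TopologicalSpace.MetrizableSpace Ω]
  [SecondCountableTopology Ω]

lemma measurable_uncurry (hf : IsRegularFamily μ f K) :
    Measurable (Function.uncurry f) :=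
  measurable_uncurry_of_continuous_of_measurable (u := f) hf.continuous hf.measurable

lemma measurable_mixtureDensity (hf : IsRegularFamily μ f K) (G : ProbabilityMeasure Ω) :
    Measurable (mixtureDensity f G) :=
  Measurable.lintegral_prod_left' (f := fun p : Ω × 𝒴 => (f p.1 p.2 : ℝ≥0∞))
    hf.measurable_uncurry.coe_nnreal_ennreal

lemma measurable_logMixture (hf : IsRegularFamily μ f K) (G : ProbabilityMeasure Ω) :
    Measurable (logMixture f G) :=
  (hf.measurable_mixtureDensity G).ennreal_toReal.log

lemma setLIntegral_mixtureDensity_le_one [Nonempty Ω] (hf : IsRegularFamily μ f K)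
    (G : ProbabilityMeasure Ω) :
    ∫⁻ y in regularSet f, mixtureDensity f G y ∂μ ≤ 1 := by
  have := hf.sFinite_restrict_regularSet
  calc ∫⁻ y in regularSet f, mixtureDensity f G y ∂μ
      = ∫⁻ θ, ∫⁻ y in regularSet f, (f θ y : ℝ≥0∞) ∂μ ∂(G : Measure Ω) :=
        lintegral_lintegral_swap (f := fun y θ => (f θ y : ℝ≥0∞))
          (hf.measurable_uncurry.comp measurable_swap).coe_nnreal_ennreal.aemeasurable
    _ ≤ ∫⁻ _, 1 ∂(G : Measure Ω) := lintegral_mono fun θ =>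
        (setLIntegral_le_lintegral _ _).trans (hf.lintegral_eq_one θ).le
    _ = 1 := by simp

end IsRegularFamily

end Family

/-! ### The uniform law of large numbers for log mixture densities -/

section UniformLLN

lemma ae_forall_data_of_ae {S 𝒴 : Type*} [MeasurableSpace S] {P : Measure S} [MeasurableSpace 𝒴]
    {Q : (n : ℕ) → Fin n → Measure 𝒴} {Y : (n : ℕ) → Fin n → S → 𝒴}
    (hY : ∀ n i, HasLaw (Y n i) (Q n i) P) {p : 𝒴 → Prop} (hp : ∀ n i, ∀ᵐ y ∂(Q n i), p y) :
    ∀ᵐ ω ∂P, ∀ n i, p (Y n i ω) := by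
  refine ae_all_iff.2 fun n => ae_all_iff.2 fun i => ?_
  refine ae_of_ae_map (hY n i).aemeasurable ?_
  rw [(hY n i).map_eq]
  exact hp n i

/-- The strong law of large numbers for a single function dominated by the envelope. -/
lemma ae_tendsto_average {Ω 𝒴 S : Type*} [TopologicalSpace Ω]
    [TopologicalSpace.SeparableSpace Ω] [Nonempty Ω] [MeasurableSpace 𝒴] {μ : Measure 𝒴}
    {f : Ω → 𝒴 → ℝ≥0} {K : ℝ≥0} [MeasurableSpace S] {P : Measure S} [IsProbabilityMeasure P]
    {θ : (n : ℕ) → Fin n → Ω} {Y : (n : ℕ) → Fin n → S → 𝒴} (hf : IsRegularFamily μ f K)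
    (hY_law : ∀ n i, HasLaw (Y n i) (sampleLaw μ f (θ n i)) P)
    (hY_indep : ∀ n, iIndepFun (Y n) P) {g : 𝒴 → ℝ} (hg : Measurable g)
    (hle : ∀ y ∈ regularSet f, |g y| ≤ realEnvelope f y) :
    ∀ᵐ ω ∂P, Tendsto (fun n : ℕ => (n : ℝ)⁻¹ *
      ∑ i, (g (Y n i ω) - ∫ y, g y ∂(sampleLaw μ f (θ n i)))) atTop (𝓝 0) := by
  have hE : ∀ n i, ∫ ω, g (Y n i ω) ∂P = ∫ y, g y ∂(sampleLaw μ f (θ n i)) := fun n i =>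
    (hY_law n i).integral_comp hg.aestronglyMeasurable
  have hE4 : ∀ n i, ∫ ω, g (Y n i ω) ^ 4 ∂P = ∫ y, g y ^ 4 ∂(sampleLaw μ f (θ n i)) := fun n i =>
    (hY_law n i).integral_comp (f := fun y => g y ^ 4) (hg.pow_const 4).aestronglyMeasurable
  have h := tendsto_average_sub_integral_of_fourth_moment (P := P)
    (X := fun n i ω => g (Y n i ω)) (K := K)
    (fun n i => by
      have := (hf.memLp_four hg hle (θ n i)).1
      rw [← (hY_law n i).map_eq, memLp_map_measure_iff hg.aestronglyMeasurable
        (hY_law n i).aemeasurable] at this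
      exact this)
    (fun n => (hY_indep n).comp (fun _ => g) fun _ => hg)
    (fun n i => (hE4 n i).trans_le (hf.memLp_four hg hle (θ n i)).2)
  simpa only [hE] using h

variable {Ω 𝒴 : Type*} [TopologicalSpace Ω] [MeasurableSpace Ω] [BorelSpace Ω] [CompactSpace Ω]
  [TopologicalSpace.MetrizableSpace Ω] [SecondCountableTopology Ω]
  [MeasurableSpace 𝒴] {μ : Measure 𝒴} {f : Ω → 𝒴 → ℝ≥0} {K : ℝ≥0}

/-- The neighbourhoods `U(G₀) = {G | ‖log f_G^{(M)} - log f_{G₀}^{(M)}‖_∞ < ε}` are weakly open. -/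
def TruncLogBallsOpen (μ : Measure 𝒴) (f : Ω → 𝒴 → ℝ≥0) : Prop :=
  ∀ (G₀ : ProbabilityMeasure Ω) (ε M : ℝ), 0 < ε → 0 < M →
    IsOpen {G : ProbabilityMeasure Ω |
      eLpNorm (fun y => truncLog M (mixtureDensity f G y)
        - truncLog M (mixtureDensity f G₀ y)) ∞ μ < ENNReal.ofReal ε}

/-- Clamping to `[-M, M]` changes a difference of two numbers bounded by `h` only if `M ≤ h`, and
the difference is then at most `2 h`. -/
lemma abs_sub_le_abs_clamp_sub {M h a b : ℝ} (ha : |a| ≤ h) (hb : |b| ≤ h) :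
    |a - b| ≤ |max (-M) (min M a) - max (-M) (min M b)| + 2 * (if M ≤ h then h else 0) := by
  rw [abs_le] at ha hb
  split_ifs with hM
  · have := abs_nonneg (max (-M) (min M a) - max (-M) (min M b))
    rw [abs_le]; constructor <;> linarith
  · rw [not_le] at hM
    rw [min_eq_right (by linarith), min_eq_right (by linarith), max_eq_right (by linarith),
      max_eq_right (by linarith)]
    simp

/-- The exceptional null set of an `L^∞` bound over an open set of mixing distributions can be
chosen independently of the mixing distribution: it suffices to remove the null sets of a
countable dense subset, since `G ↦ log f_G(y)` is weakly continuous. -/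
lemma ae_forall_abs_logMixture_sub_le (hf : IsRegularFamily μ f K) (hopen : TruncLogBallsOpen μ f)
    (G₀ : ProbabilityMeasure Ω) {ε M : ℝ} (hε : 0 < ε) (hM : 0 < M) :
    ∀ᵐ y ∂μ, y ∈ regularSet f → ∀ G : ProbabilityMeasure Ω,
      eLpNorm (fun y => truncLog M (mixtureDensity f G y)
        - truncLog M (mixtureDensity f G₀ y)) ∞ μ < ENNReal.ofReal ε →
      |logMixture f G y - logMixture f G₀ y| ≤ ε + 2 * envelopeTail f M y := by
  have : TopologicalSpace.SeparableSpace (ProbabilityMeasure Ω) := by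
    let := TopologicalSpace.metrizableSpaceMetric (ProbabilityMeasure Ω)
    infer_instance
  obtain ⟨D, hDc, hDd⟩ := TopologicalSpace.exists_countable_dense (ProbabilityMeasure Ω)
  set U : Set (ProbabilityMeasure Ω) := {G | eLpNorm (fun y => truncLog M (mixtureDensity f G y)
        - truncLog M (mixtureDensity f G₀ y)) ∞ μ < ENNReal.ofReal ε} with hU
  have hUo : IsOpen U := hopen G₀ ε M hε hM
  have hae : ∀ᵐ y ∂μ, ∀ G ∈ D, G ∈ U →
      |truncLog M (mixtureDensity f G y) - truncLog M (mixtureDensity f G₀ y)| ≤ ε := by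
    refine (ae_ball_iff hDc).2 fun G _ => ?_
    by_cases hG : G ∈ U
    · filter_upwards [ae_le_eLpNormEssSup (μ := μ) (f := fun y =>
        truncLog M (mixtureDensity f G y) - truncLog M (mixtureDensity f G₀ y))] with y hy _
      have h : eLpNorm (fun y => truncLog M (mixtureDensity f G y)
        - truncLog M (mixtureDensity f G₀ y)) ∞ μ < ENNReal.ofReal ε := hG
      rw [eLpNorm_exponent_top] at h
      have h2 := hy.trans h.le
      rwa [Real.enorm_eq_ofReal_abs, ENNReal.ofReal_le_ofReal_iff hε.le] at h2
    · exact ae_of_all _ fun y h => absurd h hG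
  filter_upwards [hae] with y hy hyA G hG
  have hcl : IsClosed {G : ProbabilityMeasure Ω |
      |max (-M) (min M (logMixture f G y)) - max (-M) (min M (logMixture f G₀ y))| ≤ ε} := by
    have := continuous_logMixture hf.continuous hyA
    exact isClosed_le (by fun_prop) continuous_const
  have hsub : U ∩ D ⊆ {G : ProbabilityMeasure Ω |
      |max (-M) (min M (logMixture f G y)) - max (-M) (min M (logMixture f G₀ y))| ≤ ε} := by
    intro G' hG'
    have := hy G' hG'.2 hG'.1
    rwa [truncLog_mixtureDensity hM hyA, truncLog_mixtureDensity hM hyA] at this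
  have hmem := hcl.closure_subset_iff.2 hsub (hDd.open_subset_closure_inter hUo hG)
  refine (abs_sub_le_abs_clamp_sub (M := M) (abs_logMixture_le hyA G)
    (abs_logMixture_le hyA G₀)).trans (add_le_add hmem le_rfl)

/-- Compactness of the space of mixing distributions yields a finite net of centres `c G` whose
log densities approximate all log densities up to the tail of the envelope. -/
lemma exists_finite_net (hf : IsRegularFamily μ f K) (hopen : TruncLogBallsOpen μ f)
    {ε M : ℝ} (hε : 0 < ε) (hM : 0 < M) :
    ∃ c : ProbabilityMeasure Ω → ProbabilityMeasure Ω, (Set.range c).Finite ∧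
      ∀ᵐ y ∂μ, y ∈ regularSet f → ∀ G : ProbabilityMeasure Ω,
        |logMixture f G y - logMixture f (c G) y| ≤ ε + 2 * envelopeTail f M y := by
  set U : ProbabilityMeasure Ω → Set (ProbabilityMeasure Ω) := fun G₀ =>
    {G | eLpNorm (fun y => truncLog M (mixtureDensity f G y)
        - truncLog M (mixtureDensity f G₀ y)) ∞ μ < ENNReal.ofReal ε} with hU
  have hmem : ∀ G, G ∈ U G := fun G => by
    simp only [hU, Set.mem_ofPred_eq, sub_self]
    rw [eLpNorm_zero']
    exact ENNReal.ofReal_pos.2 hε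
  obtain ⟨t, ht⟩ := isCompact_univ.elim_nhds_subcover U
    fun G _ => (hopen G ε M hε hM).mem_nhds (hmem G)
  have hc : ∀ G, ∃ G₀ ∈ t, G ∈ U G₀ := fun G => by
    simpa using ht.2 (Set.mem_univ G)
  choose c hct hcU using hc
  refine ⟨c, t.finite_toSet.subset (Set.range_subset_iff.2 hct), ?_⟩
  filter_upwards [(ae_ball_iff t.countable_toSet).2 fun G₀ _ =>
    ae_forall_abs_logMixture_sub_le hf hopen G₀ hε hM] with y hy hyA G
  exact hy (c G) (hct G) hyA G (hcU G)

variable [Nonempty Ω] {S : Type*} [MeasurableSpace S] {P : Measure S} [IsProbabilityMeasure P]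
  {θ : (n : ℕ) → Fin n → Ω} {Y : (n : ℕ) → Fin n → S → 𝒴}

/-- Up to an error of order `ε + K / M³`, the fluctuations of the log-likelihood are uniformly
small over all mixing distributions. -/
lemma ae_eventually_forall_abs_average_le (hf : IsRegularFamily μ f K)
    (hopen : TruncLogBallsOpen μ f)
    (hY_law : ∀ n i, HasLaw (Y n i) (sampleLaw μ f (θ n i)) P)
    (hY_indep : ∀ n, iIndepFun (Y n) P) {ε M : ℝ} (hε : 0 < ε) (hM : 0 < M) :
    ∀ᵐ ω ∂P, ∀ᶠ n : ℕ in atTop, ∀ G : ProbabilityMeasure Ω,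
      |(n : ℝ)⁻¹ * ∑ i, (logMixture f G (Y n i ω)
        - ∫ y, logMixture f G y ∂(sampleLaw μ f (θ n i)))| ≤ 5 * ε + 4 * (K / M ^ 3) := by
  obtain ⟨c, hcfin, hc⟩ := exists_finite_net hf hopen hε hM
  set T := envelopeTail f M with hT
  have hTle : ∀ y ∈ regularSet f, |T y| ≤ realEnvelope f y := fun y _ => by
    rw [abs_of_nonneg (envelopeTail_nonneg f M y)]; exact envelopeTail_le f M y
  have hcθ : ∀ θ, ∀ᵐ y ∂(sampleLaw μ f θ), ∀ G : ProbabilityMeasure Ω,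
      |logMixture f G y - logMixture f (c G) y| ≤ ε + 2 * T y := fun θ => by
    filter_upwards [(withDensity_absolutelyContinuous μ _).ae_le hc,
      hf.ae_mem_regularSet θ] with y h1 h2
    exact h1 h2
  have hlint : ∀ G θ, Integrable (logMixture f G) (sampleLaw μ f θ) := fun G θ => by
    have := hf.isProbabilityMeasure_sampleLaw θ
    exact (hf.memLp_four (hf.measurable_logMixture G)
      (fun y hy => abs_logMixture_le hy G) θ).1.integrable (by norm_num)
  have hTint : ∀ θ, Integrable T (sampleLaw μ f θ) := fun θ => by
    have := hf.isProbabilityMeasure_sampleLaw θ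
    exact (hf.memLp_four (hf.measurable_envelopeTail M) hTle θ).1.integrable (by norm_num)
  -- the same approximation for the expectations
  have hEdiff : ∀ θ G, |∫ y, logMixture f G y ∂(sampleLaw μ f θ)
      - ∫ y, logMixture f (c G) y ∂(sampleLaw μ f θ)| ≤ ε + 2 * (K / M ^ 3) := fun θ G => by
    have := hf.isProbabilityMeasure_sampleLaw θ
    rw [← integral_sub (hlint _ _) (hlint _ _)]
    calc _ ≤ ∫ y, |logMixture f G y - logMixture f (c G) y| ∂(sampleLaw μ f θ) :=
          abs_integral_le_integral_abs
      _ ≤ ∫ y, (ε + 2 * T y) ∂(sampleLaw μ f θ) := by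
          refine integral_mono_ae ((hlint _ _).sub (hlint _ _)).abs
            ((integrable_const _).add ((hTint θ).const_mul 2)) ?_
          filter_upwards [hcθ θ] with y hy using hy G
      _ = ε + 2 * ∫ y, T y ∂(sampleLaw μ f θ) := by
          rw [integral_add (integrable_const _) ((hTint θ).const_mul 2), integral_const_mul]
          simp
      _ ≤ _ := by gcongr; exact hf.integral_envelopeTail_le hM θ
  filter_upwards [ae_forall_data_of_ae hY_law fun n i => hcθ (θ n i),
    ae_tendsto_average hf hY_law hY_indep (hf.measurable_envelopeTail M) hTle,
    (ae_ball_iff hcfin.countable).2 fun G _ => ae_tendsto_average hf hY_law hY_indep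
      (hf.measurable_logMixture G) (fun y hy => abs_logMixture_le hy G)] with ω hω hωT hωc
  have hc_ev : ∀ᶠ n : ℕ in atTop, ∀ G ∈ Set.range c, |(n : ℝ)⁻¹ *
      ∑ i, (logMixture f G (Y n i ω) - ∫ y, logMixture f G y ∂(sampleLaw μ f (θ n i)))| < ε := by
    refine (eventually_all_finite hcfin).2 fun G hG => ?_
    have := (hωc G hG).abs
    rw [abs_zero] at this
    exact this.eventually_lt_const hε
  filter_upwards [hc_ev, hωT.eventually_lt_const hε, eventually_gt_atTop 0] with n hn1 hn2 hn0 G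
  have hn0' : (0 : ℝ) < n := by exact_mod_cast hn0
  have h1 := hn1 (c G) ⟨G, rfl⟩
  have hsum : |(∑ i, (logMixture f G (Y n i ω)
        - ∫ y, logMixture f G y ∂(sampleLaw μ f (θ n i))))
      - ∑ i, (logMixture f (c G) (Y n i ω)
        - ∫ y, logMixture f (c G) y ∂(sampleLaw μ f (θ n i)))| ≤
      ∑ i, (2 * (T (Y n i ω) - ∫ y, T y ∂(sampleLaw μ f (θ n i)))
        + (2 * ε + 4 * (K / M ^ 3))) := by
    rw [← Finset.sum_sub_distrib]
    refine (Finset.abs_sum_le_sum_abs _ _).trans (Finset.sum_le_sum fun i _ => ?_)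
    have a1 := abs_le.1 (hω n i G)
    have a2 := abs_le.1 (hEdiff (θ n i) G)
    have a3 := hf.integral_envelopeTail_le hM (θ n i)
    rw [abs_le]
    constructor <;> linarith [a1.1, a1.2, a2.1, a2.2]
  rw [Finset.sum_add_distrib, ← Finset.mul_sum, Finset.sum_const, Finset.card_univ,
    Fintype.card_fin, nsmul_eq_mul] at hsum
  set A := ∑ i, (logMixture f G (Y n i ω)
        - ∫ y, logMixture f G y ∂(sampleLaw μ f (θ n i)))
  set B := ∑ i, (logMixture f (c G) (Y n i ω)
        - ∫ y, logMixture f (c G) y ∂(sampleLaw μ f (θ n i)))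
  set C := ∑ i, (T (Y n i ω) - ∫ y, T y ∂(sampleLaw μ f (θ n i)))
  rw [inv_mul_eq_div, abs_div, abs_of_pos hn0', div_lt_iff₀ hn0'] at h1
  rw [inv_mul_eq_div, div_lt_iff₀ hn0'] at hn2
  rw [inv_mul_eq_div, abs_div, abs_of_pos hn0', div_le_iff₀ hn0']
  have h3 : |A| ≤ |A - B| + |B| := by simpa using abs_add_le (A - B) B
  linarith

/-- The uniform strong law of large numbers for the log-likelihood. -/
theorem ae_forall_eventually_abs_average_le (hf : IsRegularFamily μ f K)
    (hopen : TruncLogBallsOpen μ f)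
    (hY_law : ∀ n i, HasLaw (Y n i) (sampleLaw μ f (θ n i)) P)
    (hY_indep : ∀ n, iIndepFun (Y n) P) :
    ∀ᵐ ω ∂P, ∀ ε > 0, ∀ᶠ n : ℕ in atTop, ∀ G : ProbabilityMeasure Ω,
      |(n : ℝ)⁻¹ * ∑ i, (logMixture f G (Y n i ω)
        - ∫ y, logMixture f G y ∂(sampleLaw μ f (θ n i)))| ≤ ε := by
  have h := ae_all_iff.2 fun k : ℕ => ae_eventually_forall_abs_average_le hf hopen hY_law hY_indep
    (ε := 1 / ((k : ℝ) + 1)) (M := (k : ℝ) + 1) (by positivity) (by positivity)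
  filter_upwards [h] with ω hω ε hε
  -- with `ε = 1 / (k + 1)` and `M = k + 1` the error is at most `(5 + 4 K) / (k + 1)`
  obtain ⟨k, hk⟩ := exists_nat_gt ((5 + 4 * (K : ℝ)) / ε)
  filter_upwards [hω k] with n hn G
  refine (hn G).trans ?_
  have hk1 : (0 : ℝ) < (k : ℝ) + 1 := by positivity
  have h1 : (K : ℝ) / ((k : ℝ) + 1) ^ 3 ≤ K / ((k : ℝ) + 1) := by
    gcongr
    exact le_self_pow₀ (by linarith [Nat.cast_nonneg (α := ℝ) k]) (by norm_num)
  calc 5 * (1 / ((k : ℝ) + 1)) + 4 * (K / ((k : ℝ) + 1) ^ 3)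
      ≤ 5 * (1 / ((k : ℝ) + 1)) + 4 * (K / ((k : ℝ) + 1)) := by gcongr
    _ = (5 + 4 * K) / ((k : ℝ) + 1) := by ring
    _ ≤ ε := by
      rw [div_lt_iff₀ hε] at hk
      rw [div_le_iff₀ hk1]
      nlinarith

end UniformLLN

/-! ### The Kullback–Leibler divergence between mixtures -/

section Divergence

/-- The divergence `∫ (f_G - f_H - f_H log (f_G / f_H)) dμ` over the regular set. The integrand
is written as `f_G * klFun (f_H / f_G)` and so is visibly nonnegative; if both mixtures have total
mass one, this is the Kullback–Leibler divergence of the `G`-mixture from the `H`-mixture. -/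
def mixtureDivergence {Ω 𝒴 : Type*} [MeasurableSpace Ω] [MeasurableSpace 𝒴] (μ : Measure 𝒴)
    (f : Ω → 𝒴 → ℝ≥0) (G H : ProbabilityMeasure Ω) : ℝ≥0∞ :=
  ∫⁻ y in regularSet f, ENNReal.ofReal ((mixtureDensity f G y).toReal *
    InformationTheory.klFun ((mixtureDensity f H y).toReal / (mixtureDensity f G y).toReal)) ∂μ

variable {Ω 𝒴 : Type*} [TopologicalSpace Ω] [MeasurableSpace Ω] [BorelSpace Ω]
  [TopologicalSpace.MetrizableSpace Ω] [SecondCountableTopology Ω] [Nonempty Ω]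
  [MeasurableSpace 𝒴] {μ : Measure 𝒴} {f : Ω → 𝒴 → ℝ≥0} {K : ℝ≥0}

/-- The divergence is bounded by the expected log-likelihood ratio under the `H`-mixture. Only
`∫ f_G ≤ 1` is used of the other mixture. -/
lemma mixtureDivergence_le (hf : IsRegularFamily μ f K) (G H : ProbabilityMeasure Ω)
    (hH : ∫ y in regularSet f, (mixtureDensity f H y).toReal ∂μ = 1)
    (hint : IntegrableOn (fun y => (mixtureDensity f H y).toReal *
      (logMixture f H y - logMixture f G y)) (regularSet f) μ) :
    mixtureDivergence μ f G H ≤ ENNReal.ofReal (∫ y in regularSet f,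
      (mixtureDensity f H y).toReal * (logMixture f H y - logMixture f G y) ∂μ) := by
  have hint' : ∀ G, IntegrableOn (fun y => (mixtureDensity f G y).toReal) (regularSet f) μ :=
    fun G => integrable_toReal_of_lintegral_ne_top (hf.measurable_mixtureDensity G).aemeasurable
      (ne_top_of_le_ne_top ENNReal.one_ne_top (hf.setLIntegral_mixtureDensity_le_one G))
  have hG : ∫ y in regularSet f, (mixtureDensity f G y).toReal ∂μ ≤ 1 := by
    rw [integral_toReal (hf.measurable_mixtureDensity G).aemeasurable]
    · exact ENNReal.toReal_mono ENNReal.one_ne_top (hf.setLIntegral_mixtureDensity_le_one G)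
    · filter_upwards [ae_restrict_mem hf.measurableSet_regularSet] with y hy
      exact (mixtureDensity_ne_top hy G).lt_top
  have heq : ∀ y ∈ regularSet f, (mixtureDensity f G y).toReal *
      InformationTheory.klFun ((mixtureDensity f H y).toReal / (mixtureDensity f G y).toReal)
      = (mixtureDensity f H y).toReal * (logMixture f H y - logMixture f G y)
        + ((mixtureDensity f G y).toReal - (mixtureDensity f H y).toReal) := fun y hy => by
    have h1 := toReal_mixtureDensity_pos hy G
    have h2 := toReal_mixtureDensity_pos hy H
    rw [InformationTheory.klFun_apply, Real.log_div h2.ne' h1.ne', logMixture, logMixture]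
    field_simp
    ring
  have hsub : IntegrableOn (fun y => (mixtureDensity f G y).toReal
      - (mixtureDensity f H y).toReal) (regularSet f) μ := (hint' G).sub (hint' H)
  rw [mixtureDivergence, setLIntegral_congr_fun hf.measurableSet_regularSet
    (fun y hy => congrArg ENNReal.ofReal (heq y hy))]
  rw [← ofReal_integral_eq_lintegral_ofReal (hint.fun_add hsub)]
  · refine ENNReal.ofReal_le_ofReal ?_
    rw [integral_add hint hsub, integral_sub (hint' G) (hint' H), hH]
    linarith
  · filter_upwards [ae_restrict_mem hf.measurableSet_regularSet] with y hy
    rw [← heq y hy]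
    exact mul_nonneg ENNReal.toReal_nonneg (InformationTheory.klFun_nonneg (by positivity))

/-- If the divergences tend to zero, then the two sequences of mixing distributions merge weakly:
along a convergent subsequence, Fatou's lemma shows that the limits have the same mixture density,
so they agree by identifiability. -/
theorem tendsto_integral_sub_of_mixtureDivergence [CompactSpace Ω] (hf : IsRegularFamily μ f K)
    (hident : ∀ G G' : ProbabilityMeasure Ω,
      mixtureDensity f G =ᵐ[μ] mixtureDensity f G' → G = G')
    {G H : ℕ → ProbabilityMeasure Ω}
    (hGH : Tendsto (fun n => mixtureDivergence μ f (G n) (H n)) atTop (𝓝 0)) (φ : Ω →ᵇ ℝ) :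
    Tendsto (fun n => ∫ x, φ x ∂(G n : Measure Ω) - ∫ x, φ x ∂(H n : Measure Ω))
      atTop (𝓝 0) := by
  have : FirstCountableTopology (ProbabilityMeasure Ω × ProbabilityMeasure Ω) := by
    let := TopologicalSpace.metrizableSpaceMetric (ProbabilityMeasure Ω)
    infer_instance
  refine tendsto_of_subseq_tendsto fun ns hns => ?_
  obtain ⟨⟨G', H'⟩, ms, hms, hlim⟩ :=
    CompactSpace.tendsto_subseq fun k => (G (ns k), H (ns k))
  refine ⟨ms, ?_⟩
  have hGl : Tendsto (fun k => G (ns (ms k))) atTop (𝓝 G') :=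
    (continuous_fst.tendsto _).comp hlim
  have hHl : Tendsto (fun k => H (ns (ms k))) atTop (𝓝 H') :=
    (continuous_snd.tendsto _).comp hlim
  set D : ProbabilityMeasure Ω → ProbabilityMeasure Ω → 𝒴 → ℝ≥0∞ := fun G H y =>
    ENNReal.ofReal ((mixtureDensity f G y).toReal *
      InformationTheory.klFun ((mixtureDensity f H y).toReal / (mixtureDensity f G y).toReal))
    with hD
  have hDm : ∀ G H, Measurable (D G H) := fun G H =>
    ((hf.measurable_mixtureDensity G).ennreal_toReal.mul
      (InformationTheory.measurable_klFun.comp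
        ((hf.measurable_mixtureDensity H).ennreal_toReal.div
          (hf.measurable_mixtureDensity G).ennreal_toReal))).ennreal_ofReal
  have hDlim : ∀ y ∈ regularSet f,
      Tendsto (fun k => D (G (ns (ms k))) (H (ns (ms k))) y) atTop (𝓝 (D G' H' y)) :=
    fun y hy => by
      have h1 := ((continuous_toReal_mixtureDensity hf.continuous hy).tendsto G').comp hGl
      have h2 := ((continuous_toReal_mixtureDensity hf.continuous hy).tendsto H').comp hHl
      exact (ENNReal.continuous_ofReal.tendsto _).comp (h1.mul
        ((InformationTheory.continuous_klFun.tendsto _).comp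
          (h2.div h1 (toReal_mixtureDensity_pos hy G').ne')))
  have hzero : ∫⁻ y in regularSet f, D G' H' y ∂μ = 0 := by
    refine le_antisymm ?_ bot_le
    have hfatou := lintegral_liminf_le (μ := μ.restrict (regularSet f)) (u := atTop)
      fun k => hDm (G (ns (ms k))) (H (ns (ms k)))
    rw [setLIntegral_congr_fun hf.measurableSet_regularSet
      fun y hy => (hDlim y hy).liminf_eq] at hfatou
    exact hfatou.trans (hGH.comp (hns.comp hms.tendsto_atTop)).liminf_eq.le
  have hae : mixtureDensity f G' =ᵐ[μ] mixtureDensity f H' := by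
    rw [lintegral_eq_zero_iff (hDm _ _), EventuallyEq,
      ae_restrict_iff' hf.measurableSet_regularSet] at hzero
    filter_upwards [hzero, hf.ae_eq_zero_of_notMem_regularSet] with y hy1 hy2
    by_cases hy : y ∈ regularSet f
    · have hpos := toReal_mixtureDensity_pos hy G'
      have h := hy1 hy
      simp only [hD, Pi.zero_apply, ENNReal.ofReal_eq_zero] at h
      have hk : InformationTheory.klFun
          ((mixtureDensity f H' y).toReal / (mixtureDensity f G' y).toReal) = 0 :=
        le_antisymm (nonpos_of_mul_nonpos_right h hpos)
          (InformationTheory.klFun_nonneg (by positivity))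
      rw [InformationTheory.klFun_eq_zero_iff (by positivity), div_eq_one_iff_eq hpos.ne'] at hk
      exact ((ENNReal.toReal_eq_toReal_iff' (mixtureDensity_ne_top hy H')
        (mixtureDensity_ne_top hy G')).1 hk).symm
    · simp [mixtureDensity, hy2 hy]
  obtain rfl := hident _ _ hae
  have h1 := ProbabilityMeasure.tendsto_iff_forall_integral_tendsto.1 hGl φ
  have h2 := ProbabilityMeasure.tendsto_iff_forall_integral_tendsto.1 hHl φ
  simpa using h1.sub h2

end Divergence

/-! ### Empirical mixing distributions -/

section Empirical

variable {Ω 𝒴 : Type*} [MeasurableSpace Ω] {f : Ω → 𝒴 → ℝ≥0}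

lemma isProbabilityMeasure_empiricalMeasure {n : ℕ} (hn : 0 < n) (θ : Fin n → Ω) :
    IsProbabilityMeasure (empiricalMeasure θ) := by
  refine ⟨?_⟩
  have : (n : ℝ≥0∞) ≠ 0 := by exact_mod_cast hn.ne'
  simp [empiricalMeasure, ENNReal.inv_mul_cancel this]

lemma toReal_mixtureDensity_empirical [MeasurableSingletonClass Ω] {n : ℕ} {θ : Fin n → Ω}
    {H : ProbabilityMeasure Ω} (hH : (H : Measure Ω) = empiricalMeasure θ) (y : 𝒴) :
    (mixtureDensity f H y).toReal = (n : ℝ)⁻¹ * ∑ i, (f (θ i) y : ℝ) := by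
  rw [mixtureDensity, hH, empiricalMeasure, lintegral_smul_measure, lintegral_finsetSum_measure]
  simp [ENNReal.toReal_sum]

lemma integral_mixtureDensity_empirical_mul [TopologicalSpace Ω]
    [TopologicalSpace.SeparableSpace Ω] [Nonempty Ω] [MeasurableSingletonClass Ω]
    [MeasurableSpace 𝒴] {μ : Measure 𝒴} {K : ℝ≥0} (hf : IsRegularFamily μ f K)
    {n : ℕ} {θ : Fin n → Ω} {H : ProbabilityMeasure Ω}
    (hH : (H : Measure Ω) = empiricalMeasure θ) {g : 𝒴 → ℝ}
    (hg : ∀ θ, Integrable g (sampleLaw μ f θ)) :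
    IntegrableOn (fun y => (mixtureDensity f H y).toReal * g y) (regularSet f) μ ∧
    ∫ y in regularSet f, (mixtureDensity f H y).toReal * g y ∂μ
      = (n : ℝ)⁻¹ * ∑ i, ∫ y, g y ∂(sampleLaw μ f (θ i)) := by
  have hi : ∀ i, IntegrableOn (fun y => (f (θ i) y : ℝ) * g y) (regularSet f) μ := fun i => by
    have := hg (θ i)
    rw [← hf.sampleLaw_restrict, sampleLaw,
      integrable_withDensity_iff_integrable_smul (hf.measurable _)] at this
    simpa [IntegrableOn, NNReal.smul_def] using this
  simp_rw [toReal_mixtureDensity_empirical hH, mul_assoc, Finset.sum_mul]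
  refine ⟨(integrable_finsetSum _ fun i _ => hi i).const_mul _, ?_⟩
  rw [integral_const_mul, integral_finsetSum _ fun i _ => hi i]
  simp_rw [hf.integral_sampleLaw]

end Empirical

/-! ### Consistency of the generalized maximum likelihood estimate -/

lemma IsGMLE.sum_logMixture_le {Ω 𝒴 : Type*} [MeasurableSpace Ω] {f : Ω → 𝒴 → ℝ≥0} {n : ℕ}
    {y : Fin n → 𝒴} {G : ProbabilityMeasure Ω} (hG : IsGMLE f y G)
    (hy : ∀ i, y i ∈ regularSet f) (H : ProbabilityMeasure Ω) :
    ∑ i, logMixture f H (y i) ≤ ∑ i, logMixture f G (y i) := by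
  have h := ENNReal.toReal_mono
    (ENNReal.prod_ne_top fun i _ => mixtureDensity_ne_top (hy i) G) (hG H)
  rw [ENNReal.toReal_prod, ENNReal.toReal_prod] at h
  have h2 := Real.log_le_log
    (Finset.prod_pos fun i _ => toReal_mixtureDensity_pos (hy i) H) h
  rwa [Real.log_prod fun i _ => (toReal_mixtureDensity_pos (hy i) H).ne',
    Real.log_prod fun i _ => (toReal_mixtureDensity_pos (hy i) G).ne'] at h2

section Consistency

variable {Ω 𝒴 : Type*} [TopologicalSpace Ω] [MeasurableSpace Ω] [BorelSpace Ω]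
  [TopologicalSpace.MetrizableSpace Ω] [SecondCountableTopology Ω] [Nonempty Ω]
  [MeasurableSpace 𝒴] {μ : Measure 𝒴} {f : Ω → 𝒴 → ℝ≥0} {K : ℝ≥0}

/-- For one realization `y` of the array that satisfies the uniform law of large numbers, the
divergence of the estimated mixture from the true one tends to zero. -/
lemma tendsto_mixtureDivergence_of_isGMLE (hf : IsRegularFamily μ f K)
    {θ : (n : ℕ) → Fin n → Ω} {y : (n : ℕ) → Fin n → 𝒴} {G H : ℕ → ProbabilityMeasure Ω}
    (hH : ∀ n, 0 < n → (H n : Measure Ω) = empiricalMeasure (θ n))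
    (hy : ∀ n i, y n i ∈ regularSet f) (hG : ∀ n, IsGMLE f (y n) (G n))
    (hULLN : ∀ ε > 0, ∀ᶠ n : ℕ in atTop, ∀ G : ProbabilityMeasure Ω,
      |(n : ℝ)⁻¹ * ∑ i, (logMixture f G (y n i)
        - ∫ y, logMixture f G y ∂(sampleLaw μ f (θ n i)))| ≤ ε) :
    Tendsto (fun n => mixtureDivergence μ f (G n) (H n)) atTop (𝓝 0) := by
  have hlint : ∀ G θ, Integrable (logMixture f G) (sampleLaw μ f θ) := fun G θ => by
    have := hf.isProbabilityMeasure_sampleLaw θ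
    exact (hf.memLp_four (hf.measurable_logMixture G)
      (fun y hy => abs_logMixture_le hy G) θ).1.integrable (by norm_num)
  refine ENNReal.tendsto_nhds_zero.2 fun δ hδ => ?_
  obtain ⟨ε, hε, hεδ⟩ : ∃ ε : ℝ, 0 < ε ∧ ENNReal.ofReal (2 * ε) ≤ δ := by
    obtain ⟨r, hr0, hr⟩ := ENNReal.lt_iff_exists_nnreal_btwn.1 hδ
    refine ⟨r / 2, by simpa using hr0, ?_⟩
    rw [mul_div_cancel₀ _ two_ne_zero, ENNReal.ofReal_coe_nnreal]
    exact hr.le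
  filter_upwards [hULLN ε hε, eventually_gt_atTop 0] with n hn hn0
  refine le_trans ?_ hεδ
  have hn0' : (n : ℝ) ≠ 0 := by exact_mod_cast hn0.ne'
  -- the choice `g = 1` shows that the true mixture has total mass one
  have hone := (integral_mixtureDensity_empirical_mul hf (hH n hn0) (g := fun _ => 1)
    fun θ => by
      have := hf.isProbabilityMeasure_sampleLaw θ
      exact integrable_const _).2
  have hone' : ∀ i, ∫ _, (1 : ℝ) ∂(sampleLaw μ f (θ n i)) = 1 := fun i => by
    have := hf.isProbabilityMeasure_sampleLaw (θ n i)
    simp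
  simp_rw [hone'] at hone
  simp only [mul_one, Finset.sum_const, Finset.card_univ, Fintype.card_fin, nsmul_eq_mul,
    inv_mul_cancel₀ hn0'] at hone
  obtain ⟨hint, heq⟩ := integral_mixtureDensity_empirical_mul hf (hH n hn0)
    (g := fun y => logMixture f (H n) y - logMixture f (G n) y)
    fun θ => (hlint _ θ).sub (hlint _ θ)
  refine (mixtureDivergence_le hf (G n) (H n) hone hint).trans (ENNReal.ofReal_le_ofReal ?_)
  rw [heq]
  simp_rw [integral_sub (hlint (H n) _) (hlint (G n) _)]
  have h1 := (abs_le.1 (hn (H n))).1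
  have h2 := (abs_le.1 (hn (G n))).2
  have h3 : (n : ℝ)⁻¹ * ∑ i, logMixture f (H n) (y n i)
      ≤ (n : ℝ)⁻¹ * ∑ i, logMixture f (G n) (y n i) := by
    gcongr ?_ * ?_
    exact (hG n).sum_logMixture_le (hy n) (H n)
  rw [Finset.sum_sub_distrib, mul_sub] at h1 h2 ⊢
  linarith

end Consistency

end GMLE

end

theorem mainTheorem1
    {Ω : Type*} [TopologicalSpace Ω] [TopologicalSpace.MetrizableSpace Ω]
    [MeasurableSpace Ω] [BorelSpace Ω]
    {𝒴 : Type*} [MeasurableSpace 𝒴] (μ : Measure 𝒴)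
    -- the parametric family of probability densities `f θ y = f(y|θ)` with respect to `μ`
    (f : Ω → 𝒴 → ℝ≥0)
    (hf_meas : ∀ θ, Measurable (f θ))
    (hf_dens : ∀ θ, ∫⁻ y, (f θ y : ℝ≥0∞) ∂μ = 1)
    -- A1: the parameter space is compact
    (A1 : CompactSpace Ω)
    -- A2: a uniform fourth moment bound for `h(y) = sup_θ |log f(y|θ)|`
    (A2 : ⨆ θ, ∫⁻ y, GMLE.logEnvelope f y ^ 4
      ∂(μ.withDensity fun y => (f θ y : ℝ≥0∞)) < ∞)
    -- A3: continuity in the parameter, and uniform boundedness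
    (A3_cont : ∀ y, Continuous fun θ => f θ y)
    (A3_bdd : ∃ C : ℝ≥0, ∀ θ y, f θ y ≤ C)
    -- A4: mixtures are identifiable from their densities
    (A4 : ∀ G G' : ProbabilityMeasure Ω,
      GMLE.mixtureDensity f G =ᵐ[μ] GMLE.mixtureDensity f G' → G = G')
    -- A5: sup-norm balls of truncated log densities are weakly open
    (A5 : ∀ (G₀ : ProbabilityMeasure Ω) (ε M : ℝ), 0 < ε → 0 < M →
      IsOpen {G : ProbabilityMeasure Ω |
        eLpNorm (fun y => GMLE.truncLog M (GMLE.mixtureDensity f G y)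
          - GMLE.truncLog M (GMLE.mixtureDensity f G₀ y)) ∞ μ < ENNReal.ofReal ε})
    -- the triangular array of fixed parameters
    (θ : (n : ℕ) → Fin n → Ω)
    -- the observations: independent within each row, `Y n i` with density `f (θ n i)`
    {S : Type*} [MeasurableSpace S] (P : Measure S) [IsProbabilityMeasure P]
    (Y : (n : ℕ) → Fin n → S → 𝒴)
    (hY_law : ∀ n i, HasLaw (Y n i) (μ.withDensity fun y => (f (θ n i) y : ℝ≥0∞)) P)
    (hY_indep : ∀ n, iIndepFun (Y n) P)
    -- any sequence of GMLEs
    (Ghat : ℕ → S → ProbabilityMeasure Ω)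
    (hGhat : ∀ n, ∀ᵐ ω ∂P, GMLE.IsGMLE f (fun i => Y n i ω) (Ghat n ω)) :
    (∀ φ : Ω →ᵇ ℝ, ∀ᵐ ω ∂P,
      Tendsto (fun n => ∫ x, φ x ∂(Ghat n ω : Measure Ω)
        - ∫ x, φ x ∂(GMLE.empiricalMeasure (θ n))) atTop (𝓝 0)) ∧
    (∀ᵐ ω ∂P, ∀ φ : Ω →ᵇ ℝ,
      Tendsto (fun n => ∫ x, φ x ∂(Ghat n ω : Measure Ω)
        - ∫ x, φ x ∂(GMLE.empiricalMeasure (θ n))) atTop (𝓝 0)) := by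
  have : SecondCountableTopology Ω := by
    let := TopologicalSpace.metrizableSpaceMetric Ω
    infer_instance
  have : Nonempty Ω := ⟨θ 1 0⟩
  obtain ⟨K, hK, -⟩ := ENNReal.lt_iff_exists_coe.1 A2
  have hf : GMLE.IsRegularFamily μ f K :=
    ⟨hf_meas, hf_dens, A3_cont, fun θ => hK ▸ le_iSup (fun θ => ∫⁻ y, GMLE.logEnvelope f y ^ 4
      ∂(μ.withDensity fun y => (f θ y : ℝ≥0∞))) θ⟩
  -- the empirical measure of the empty row `n = 0` is the zero measure, so that row is excluded
  have hH : ∀ n, ∃ H : ProbabilityMeasure Ω,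
      0 < n → (H : Measure Ω) = GMLE.empiricalMeasure (θ n) := fun n => by
    rcases Nat.eq_zero_or_pos n with rfl | hn
    · exact ⟨⟨Measure.dirac (θ 1 0), inferInstance⟩, fun h => absurd h (lt_irrefl 0)⟩
    · exact ⟨⟨_, GMLE.isProbabilityMeasure_empiricalMeasure hn (θ n)⟩, fun _ => rfl⟩
  choose H hH using hH
  suffices h : ∀ᵐ ω ∂P, ∀ φ : Ω →ᵇ ℝ,
      Tendsto (fun n => ∫ x, φ x ∂(Ghat n ω : Measure Ω)
        - ∫ x, φ x ∂(GMLE.empiricalMeasure (θ n))) atTop (𝓝 0) from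
    ⟨fun φ => h.mono fun ω hω => hω φ, h⟩
  filter_upwards [ae_all_iff.2 hGhat,
    GMLE.ae_forall_data_of_ae hY_law fun n i => hf.ae_mem_regularSet (θ n i),
    GMLE.ae_forall_eventually_abs_average_le hf A5 hY_law hY_indep] with ω hω1 hω2 hω3 φ
  refine (GMLE.tendsto_integral_sub_of_mixtureDivergence hf A4
    (GMLE.tendsto_mixtureDivergence_of_isGMLE hf hH hω2 hω1 hω3) φ).congr' ?_
  filter_upwards [eventually_gt_atTop 0] with n hn
  rw [hH n hn]
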